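/- A rank-one cutting-and-stacking construction consists of columns $C_n$ ($n\ge 0$), each an ordered list of $h_n$ pairwise disjoint half-open intervals (levels) of equal length in $\mathbb{R}$. Column $C_0$ is the unit interval, and $C_{n+1}$ is obtained from $C_n$ by cutting $C_n$ into $r_n\ge 2$ subcolumns of equal width, placing $s_{n,k}\ge 0$ new levels above the $k$-th subcolumn ($0\le k<r_n$), and stacking every subcolumn under the subcolumn to its right. Let $X$ be the union of all levels of all columns, with Lebesgue measure $\mu$, and let $T:X\to X$ be the associated rank-one transformation, that is, the common extension of the column maps sending each non-top level of $C_n$ by translation onto the level directly above it. The $n$-th height set is $$H_n=\{0\}\cup\Big\{\sum_{l=0}^{i}(h_n+s_{n,l}) : 0\le i<r_n-1\Big\}.$$ Theorem. Let $M_k,\Gamma_k,\gamma_k$ ($k\ge 0$) be nonnegative integers with $\gamma_k=\Gamma_k>0$ for all $k$. Suppose that for every $k$ the height set $H=H_k$ consists of $2\Gamma_k+2\gamma_k$ distinct nonnegative integers $V_1,W_1,\dots,V_{\Gamma_k},W_{\Gamma_k},v_1,w_1,\dots,v_{\gamma_k},w_{\gamma_k}$ such that, with $H(U)=\{\{V_i,W_i\}: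 1\le i\le \Gamma_k\}$ and $H(L)=\{\{v_j,w_j\}:1\le j\le\gamma_k\}$, 1. $V+W=v+w-1$ for all $\{V,W\}\in H(U)$ and $\{v,w\}\in H(L)$; 2. if $x_1,x_2,x_3,x_4\in H$ and $|x_1+x_2-x_3-x_4|<M_k$, then precisely one of the following holds: (a) $\{x_1,x_2\}=\{x_3,x_4\}$; (b) $\{x_1,x_2\}\ne\{x_3,x_4\}$, $x_1+x_2=x_3+x_4$, and $\{x_1,x_2\},\{x_3,x_4\}$ both belong to $H(U)$ or both belong to $H(L)$; (c) $x_1+x_2=x_3+x_4-1$, $\{x_1,x_2\}\in H(U)$ and $\{x_3,x_4\}\in H(L)$; (d) $x_1+x_2=x_3+x_4+1$, $\{x_1,x_2\}\in H(L)$ and $\{x_3,x_4\}\in H(U)$. Then $T\times T$ is ergodic with respect to $\mu\times\mu$ on $X\times X$. -/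

import Mathlib

open MeasureTheory

/-- Cutting parameters `r n` (number of subcolumns into which the `n`-th column is cut) and spacer
parameters `s n k` (number of spacers put above the `k`-th subcolumn, `0 ≤ k < r n`). -/
structure CutSpacerData where
  r : ℕ → ℕ
  s : ℕ → ℕ → ℕ
  two_le_r : ∀ n, 2 ≤ r n

namespace CutSpacerData

/-- The number `h_n` of levels of the `n`-th column. -/
def height (P : CutSpacerData) : ℕ → ℕ
  | 0 => 1
  | n + 1 => ∑ k ∈ Finset.range (P.r n), (P.height n + P.s n k)

/-- The common length of the levels of the `n`-th column. -/
noncomputable def width (P : CutSpacerData) : ℕ → ℝ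
  | 0 => 1
  | n + 1 => P.width n / P.r n

/-- The height, in column `n + 1`, of the bottom of the `k`-th subcolumn of column `n`. -/
def offset (P : CutSpacerData) (n k : ℕ) : ℕ :=
  ∑ l ∈ Finset.range k, (P.height n + P.s n l)

/-- The height set `H_n = {0} ∪ {∑_{l ≤ i} (h_n + s_{n,l}) : 0 ≤ i < r_n - 1}`: the heights in
column `n + 1` of the descendants of the base of column `n`. -/
def heightSet (P : CutSpacerData) (n : ℕ) : Finset ℕ :=
  (Finset.range (P.r n)).image (P.offset n)

end CutSpacerData

/-- A rank-one cutting-and-stacking construction: a sequence of columns of intervals of the real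
line. `left n j` is the left endpoint of the level of height `j < h_n` of the `n`-th column (other
values are irrelevant). Column `0` is the unit interval; column `n + 1` arises from column `n` by
cutting it into `r n` subcolumns of equal width, putting `s n k` new intervals above the `k`-th
subcolumn and stacking every subcolumn under the one to its right. -/
structure RankOneConstruction extends CutSpacerData where
  left : ℕ → ℕ → ℝ
  left_zero : left 0 0 = 0
  left_succ : ∀ n k j, k < r n → j < toCutSpacerData.height n →
    left (n + 1) (toCutSpacerData.offset n k + j)
      = left n j + k * toCutSpacerData.width (n + 1)
  disjoint_levels : ∀ n i j, i < toCutSpacerData.height n → j < toCutSpacerData.height n → i ≠ j →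
    Disjoint (Set.Ico (left n i) (left n i + toCutSpacerData.width n))
      (Set.Ico (left n j) (left n j + toCutSpacerData.width n))

namespace RankOneConstruction

/-- The level of height `j` of the `n`-th column. -/
def level (C : RankOneConstruction) (n j : ℕ) : Set ℝ :=
  Set.Ico (C.left n j) (C.left n j + C.width n)

/-- The space `X`, the union of all columns. -/
def space (C : RankOneConstruction) : Set ℝ :=
  {x | ∃ n j, j < C.height n ∧ x ∈ C.level n j}

/-- `C.MovesTo x y`: for some `n`, the `n`-th column map, which translates each level but the top
one onto the level directly above it, is defined at `x` and sends `x` to `y`. -/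
def MovesTo (C : RankOneConstruction) (x y : ℝ) : Prop :=
  ∃ n j, j + 1 < C.height n ∧ x ∈ C.level n j ∧ y = x - C.left n j + C.left n (j + 1)

theorem MovesTo.mem_space {C : RankOneConstruction} {x y : ℝ} (h : C.MovesTo x y) :
    y ∈ C.space := by
  obtain ⟨n, j, hj, hx, rfl⟩ := h
  refine ⟨n, j + 1, hj, ?_⟩
  simp only [level, Set.mem_Ico] at hx ⊢
  constructor <;> linarith [hx.1, hx.2]

/-- Lebesgue measure on `X`. -/
noncomputable def measure (C : RankOneConstruction) : Measure C.space :=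
  Measure.comap Subtype.val volume

open Classical in
/-- The rank-one transformation `T`, the common extension (pointwise limit) of the column maps.
As levels are half-open, every point of `X` is in the domain of some column map, so the last case
does not occur. -/
noncomputable def transformation (C : RankOneConstruction) (x : C.space) : C.space :=
  if h : ∃ y, C.MovesTo x y then ⟨h.choose, h.choose_spec.mem_space⟩ else x

end RankOneConstruction

/-- `H` consists of the `2Γ + 2γ` distinct nonnegative integers `V_i, W_i` (`i < Γ`) and
`v_j, w_j` (`j < γ`), and with `HU = {{V_i, W_i}}`, `HL = {{v_j, w_j}}` (unordered pairs)
* `V + W = v + w - 1` for all `{V, W} ∈ HU`, `{v, w} ∈ HL`;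
* if `x₁, x₂, x₃, x₄ ∈ H` and `|x₁ + x₂ - x₃ - x₄| < M`, then one of four (mutually exclusive)
  alternatives holds. -/
def IsPairedHeightSet (M Γ γ : ℕ) (H : Finset ℕ) : Prop :=
  ∃ (V W : Fin Γ → ℕ) (v w : Fin γ → ℕ),
    Function.Injective (Sum.elim (Sum.elim V W) (Sum.elim v w)) ∧
    (H : Set ℕ) = Set.range V ∪ Set.range W ∪ Set.range v ∪ Set.range w ∧
    (∀ i j, ((V i : ℤ) + W i = v j + w j - 1)) ∧
    ∀ HU HL : Set (Sym2 ℕ),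
      HU = Set.range (fun i => s(V i, W i)) → HL = Set.range (fun j => s(v j, w j)) →
      ∀ x₁ ∈ H, ∀ x₂ ∈ H, ∀ x₃ ∈ H, ∀ x₄ ∈ H,
        |(x₁ : ℤ) + x₂ - x₃ - x₄| < M →
          s(x₁, x₂) = s(x₃, x₄) ∨
          (s(x₁, x₂) ≠ s(x₃, x₄) ∧ x₁ + x₂ = x₃ + x₄ ∧
            ((s(x₁, x₂) ∈ HU ∧ s(x₃, x₄) ∈ HU) ∨ (s(x₁, x₂) ∈ HL ∧ s(x₃, x₄) ∈ HL))) ∨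
          ((x₁ : ℤ) + x₂ = x₃ + x₄ - 1 ∧ s(x₁, x₂) ∈ HU ∧ s(x₃, x₄) ∈ HL) ∨
          ((x₁ : ℤ) + x₂ = x₃ + x₄ + 1 ∧ s(x₁, x₂) ∈ HL ∧ s(x₃, x₄) ∈ HU)

/-! Let `A` be invariant under `T × T`, and let `F n i j` be the proportion of `A` in the product of
levels `i` and `j` of column `n`. Invariance makes `F n` constant along diagonals, and cutting makes
`F n i j` the mean of `F (n + 1) (i + p) (j + q)` over `p, q` in the height set.

Since `V + W + 1 = v + w`, a diagonal shift carries position `(i + V, j + w)` to `(i + v, j + 1 +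
W)`. With `Γ = γ`, such pairs are a quarter of all pairs (`IsPairedHeightSet.exists_match`), so `F n
i j` and `F n i (j + 1)` share a partial mean over a quarter of their refinements. If they differ,
one of them is far from the shared mean, so refinement raises the mean square of `F` by a definite
amount. Mean squares are at most `1`, so this cannot recur indefinitely; hence the two densities
agree (`density_eq_succ`).

All densities are thus one constant `c` (`density_eq`). As products of levels generate the
σ-algebra, the restriction of the product measure to `A` is `c` times that measure
(`restrict_eq_smul`). Evaluating on the complement of `A` shows that `c = 0` or the complement is
null. -/

namespace CutSpacerData

/-! ### Arithmetic of heights, offsets and widths. -/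

variable (P : CutSpacerData)

theorem r_pos (n : ℕ) : 0 < P.r n := by have := P.two_le_r n; omega

theorem offset_succ (n k : ℕ) : P.offset n (k + 1) = P.offset n k + (P.height n + P.s n k) := by
  simp [offset, Finset.sum_range_succ]

theorem height_succ (n : ℕ) : P.height (n + 1) = P.offset n (P.r n) := rfl

theorem monotone_offset (n : ℕ) : Monotone (P.offset n) :=
  monotone_nat_of_le_succ fun k => by rw [offset_succ]; omega

theorem height_pos (n : ℕ) : 0 < P.height n := by
  induction n with
  | zero => simp [height]
  | succ n ih =>
    have h1 := P.monotone_offset n (P.r_pos n : 0 + 1 ≤ P.r n)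
    rw [offset_succ, ← height_succ] at h1
    omega

theorem strictMono_offset (n : ℕ) : StrictMono (P.offset n) :=
  strictMono_nat_of_lt_succ fun k => by
    rw [offset_succ]; have := P.height_pos n; omega

theorem offset_add_lt {n k j : ℕ} (hk : k < P.r n) (hj : j < P.height n) :
    P.offset n k + j < P.height (n + 1) := by
  have h1 := P.monotone_offset n (hk : k + 1 ≤ P.r n)
  rw [offset_succ, ← height_succ] at h1
  omega

theorem card_heightSet (n : ℕ) : (P.heightSet n).card = P.r n := by
  rw [heightSet, Finset.card_image_of_injective _ (P.strictMono_offset n).injective,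
    Finset.card_range]

theorem width_pos (n : ℕ) : 0 < P.width n := by
  induction n with
  | zero => simp [width]
  | succ n ih =>
    have : (0 : ℝ) < P.r n := by exact_mod_cast P.r_pos n
    simp only [width]; positivity

theorem r_mul_width (n : ℕ) : P.r n * P.width (n + 1) = P.width n := by
  have : (0 : ℝ) < P.r n := by exact_mod_cast P.r_pos n
  simp only [width]; field_simp

theorem width_le (n : ℕ) : P.width n ≤ (1 / 2) ^ n := by
  induction n with
  | zero => simp [width]
  | succ n ih =>
    have h2 : (2 : ℝ) ≤ P.r n := by exact_mod_cast P.two_le_r n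
    have := P.r_mul_width n
    have := P.width_pos (n + 1)
    rw [pow_succ]
    nlinarith

theorem exists_width_lt {ε : ℝ} (hε : 0 < ε) (N : ℕ) : ∃ n, N ≤ n ∧ P.width n < ε := by
  obtain ⟨m, hm⟩ := exists_pow_lt_of_lt_one hε (by norm_num : (1 / 2 : ℝ) < 1)
  refine ⟨max N m, le_max_left _ _, (P.width_le _).trans_lt (lt_of_le_of_lt ?_ hm)⟩
  exact pow_le_pow_of_le_one (by norm_num) (by norm_num) (le_max_right _ _)

end CutSpacerData

namespace RankOneConstruction

/-! ### Refinement of levels and well-definedness of the column maps. -/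

variable (C : RankOneConstruction)

theorem level_subset {n k j : ℕ} (hk : k < C.r n) (hj : j < C.height n) :
    C.level (n + 1) (C.offset n k + j) ⊆ C.level n j := by
  intro x hx
  have hl := C.left_succ n k j hk hj
  have hw := C.r_mul_width n
  have hp := C.width_pos (n + 1)
  have hk' : (k : ℝ) + 1 ≤ C.r n := by exact_mod_cast hk
  have hk0 : (0 : ℝ) ≤ k := k.cast_nonneg
  simp only [level, Set.mem_Ico, hl] at hx ⊢
  constructor <;> nlinarith [hx.1, hx.2]

theorem exists_mem_level_succ {n j : ℕ} {x : ℝ} (hj : j < C.height n) (hx : x ∈ C.level n j) :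
    ∃ k < C.r n, x ∈ C.level (n + 1) (C.offset n k + j) := by
  have hw := C.r_mul_width n
  have hp := C.width_pos (n + 1)
  simp only [level, Set.mem_Ico] at hx
  have h0 : 0 ≤ (x - C.left n j) / C.width (n + 1) := div_nonneg (by linarith [hx.1]) hp.le
  have hk : ⌊(x - C.left n j) / C.width (n + 1)⌋₊ < C.r n := by
    rw [Nat.floor_lt h0, div_lt_iff₀ hp]; linarith [hx.2]
  refine ⟨_, hk, ?_⟩
  have h1 := Nat.floor_le h0
  have h2 := Nat.lt_floor_add_one ((x - C.left n j) / C.width (n + 1))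
  rw [le_div_iff₀ hp] at h1
  rw [div_lt_iff₀ hp] at h2
  simp only [level, Set.mem_Ico, C.left_succ n _ j hk hj]
  constructor <;> linarith

theorem eq_of_mem_level {n i j : ℕ} {x : ℝ} (hi : i < C.height n) (hj : j < C.height n)
    (hx : x ∈ C.level n i) (hy : x ∈ C.level n j) : i = j := by
  by_contra h
  exact Set.disjoint_left.1 (C.disjoint_levels n i j hi hj h) hx hy

/-- The copy of a level containing a given point at a later stage; the copies of the levels above
it sit above it in the same relative position. -/
theorem exists_copy {n m j : ℕ} {x : ℝ} (hnm : n ≤ m) (hj : j < C.height n)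
    (hx : x ∈ C.level n j) :
    ∃ i < C.height m, x ∈ C.level m i ∧ C.level m i ⊆ C.level n j ∧ j ≤ i ∧
      ∀ t, j + t < C.height n → i + t < C.height m ∧
        C.left m (i + t) - C.left m i = C.left n (j + t) - C.left n j := by
  induction m, hnm using Nat.le_induction with
  | base => exact ⟨j, hj, hx, subset_rfl, le_rfl, fun t ht => ⟨ht, rfl⟩⟩
  | succ m hnm ih =>
    obtain ⟨i, hi, hxi, hsub, hji, ht⟩ := ih
    obtain ⟨k, hk, hxk⟩ := C.exists_mem_level_succ hi hxi
    refine ⟨_, C.offset_add_lt hk hi, hxk, (C.level_subset hk hi).trans hsub, by omega, ?_⟩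
    intro t htn
    obtain ⟨h1, h2⟩ := ht t htn
    rw [add_assoc, C.left_succ m k _ hk h1, C.left_succ m k _ hk hi]
    exact ⟨C.offset_add_lt hk h1, by linarith⟩

theorem exists_mem_level_of_le {n m j : ℕ} {x : ℝ} (hnm : n ≤ m) (hj : j < C.height n)
    (hx : x ∈ C.level n j) : ∃ i < C.height m, x ∈ C.level m i :=
  let ⟨i, hi, h, _⟩ := C.exists_copy hnm hj hx
  ⟨i, hi, h⟩

theorem level_subset_or_disjoint {n m i j : ℕ} (hnm : n ≤ m) (hj : j < C.height n)
    (hi : i < C.height m) : C.level m i ⊆ C.level n j ∨ Disjoint (C.level m i) (C.level n j) := by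
  by_cases h : Disjoint (C.level m i) (C.level n j)
  · exact .inr h
  · obtain ⟨x, hx, hy⟩ := Set.not_disjoint_iff.1 h
    obtain ⟨i', hi', hx', hsub, -⟩ := C.exists_copy hnm hj hy
    rw [C.eq_of_mem_level hi hi' hx hx']
    exact .inl hsub

theorem movesTo_unique_of_le {x : ℝ} {n m j i : ℕ} (hnm : n ≤ m) (hj : j + 1 < C.height n)
    (hx : x ∈ C.level n j) (hi : i + 1 < C.height m) (hxi : x ∈ C.level m i) :
    x - C.left n j + C.left n (j + 1) = x - C.left m i + C.left m (i + 1) := by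
  obtain ⟨i', hi', hx', -, -, ht⟩ := C.exists_copy hnm (by omega) hx
  obtain rfl := C.eq_of_mem_level (by omega) hi' hxi hx'
  have := (ht 1 hj).2
  linarith

theorem MovesTo.unique {C : RankOneConstruction} {x y z : ℝ} (hy : C.MovesTo x y)
    (hz : C.MovesTo x z) : y = z := by
  obtain ⟨n, j, hj, hx, rfl⟩ := hy
  obtain ⟨m, i, hi, hx', rfl⟩ := hz
  rcases le_total n m with h | h
  · exact C.movesTo_unique_of_le h hj hx hi hx'
  · exact (C.movesTo_unique_of_le h hi hx' hj hx).symm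

/-- A point always in a top level is always in the last subcolumn, so the right endpoint of its
level never moves while the width tends to `0`. Levels being half-open, the point lies strictly
below that endpoint, a contradiction. -/
theorem exists_mem_not_top (x : C.space) :
    ∃ n j, j + 1 < C.height n ∧ (x : ℝ) ∈ C.level n j := by
  obtain ⟨x, n, j, hj, hx⟩ := x
  by_contra! hcon
  have key : ∀ d, ∃ i < C.height (n + d), x ∈ C.level (n + d) i ∧
      C.left (n + d) i + C.width (n + d) = C.left n j + C.width n := by
    intro d
    induction d with
    | zero => exact ⟨j, hj, hx, rfl⟩
    | succ d ih =>
      obtain ⟨i, hi, hxi, he⟩ := ih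
      obtain ⟨k, hk, hxk⟩ := C.exists_mem_level_succ hi hxi
      refine ⟨_, C.offset_add_lt hk hi, hxk, ?_⟩
      have hkr : k + 1 = C.r (n + d) := by
        by_contra hne
        refine hcon (n + d + 1) _ ?_ hxk
        have h1 := C.offset_add_lt (show k + 1 < C.r (n + d) by omega) (C.height_pos (n + d))
        rw [C.offset_succ] at h1
        omega
      have hw := C.r_mul_width (n + d)
      rw [← hkr] at hw
      push_cast at hw
      have hl := C.left_succ (n + d) k i hk hi
      rw [← he, ← hw]
      exact (congrArg (· + C.width (n + d + 1)) hl).trans (by ring)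
  have hx2 : x < C.left n j + C.width n := hx.2
  obtain ⟨m, hm, hlt⟩ := C.exists_width_lt (sub_pos.2 hx2) n
  obtain ⟨d, rfl⟩ := Nat.exists_eq_add_of_le hm
  obtain ⟨i, -, hxi, he⟩ := key d
  have : C.left (n + d) i ≤ x := hxi.1
  linarith

theorem left_bottom (n : ℕ) : C.left n 0 = 0 := by
  induction n with
  | zero => exact C.left_zero
  | succ n ih =>
    simpa [ih, CutSpacerData.offset] using C.left_succ n 0 0 (C.r_pos n) (C.height_pos n)

/-- The bottom levels `[0, width)` shrink to `{0}`. -/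
theorem exists_mem_not_bottom (x : C.space) (hx : (x : ℝ) ≠ 0) :
    ∃ n j, j + 1 < C.height n ∧ (x : ℝ) ∈ C.level n (j + 1) := by
  obtain ⟨x, n, j, hj, hxj⟩ := x
  by_contra! hcon
  have key : ∀ m ≥ n, 0 ≤ x ∧ x < C.width m := by
    intro m hm
    obtain ⟨i, hi, hxi⟩ := C.exists_mem_level_of_le hm hj hxj
    rcases i with _ | i
    · simpa [level, left_bottom] using hxi
    · exact absurd hxi (hcon m i hi)
  obtain ⟨m, hm, hlt⟩ := C.exists_width_lt
    (lt_of_le_of_ne (key n le_rfl).1 (Ne.symm hx)) n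
  linarith [(key m hm).2]

/-! ### The transformation on levels, and its invariant measure. -/

theorem transformation_apply {x : C.space} {n j : ℕ} (hj : j + 1 < C.height n)
    (hx : (x : ℝ) ∈ C.level n j) :
    (C.transformation x : ℝ) = x - C.left n j + C.left n (j + 1) := by
  have h : ∃ y, C.MovesTo x y := ⟨_, n, j, hj, hx, rfl⟩
  rw [transformation, dif_pos h]
  exact h.choose_spec.unique ⟨n, j, hj, hx, rfl⟩

theorem transformation_mem_level {x : C.space} {n j : ℕ} (hj : j + 1 < C.height n)
    (hx : (x : ℝ) ∈ C.level n j) : (C.transformation x : ℝ) ∈ C.level n (j + 1) := by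
  rw [C.transformation_apply hj hx]
  simp only [level, Set.mem_Ico] at hx ⊢
  constructor <;> linarith [hx.1, hx.2]

/-- For the forward direction, the image of `x` is translated back down into level `j`. In a common
later column, `x` and this translate both sit one level below the image, so disjointness of levels
puts them in the same level. -/
theorem transformation_mem_level_iff {x : C.space} {n j : ℕ} (hj : j + 1 < C.height n) :
    (C.transformation x : ℝ) ∈ C.level n (j + 1) ↔ (x : ℝ) ∈ C.level n j := by
  refine ⟨fun h => ?_, C.transformation_mem_level hj⟩
  obtain ⟨m, i, hi, hx⟩ := C.exists_mem_not_top x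
  obtain ⟨i₁, hi₁, hx₁, -, -, ht₁⟩ := C.exists_copy (le_max_left m n) (by omega) hx
  have hi₁' := (ht₁ 1 hi).1
  have hT := C.transformation_mem_level hi₁' hx₁
  have hy : (C.transformation x : ℝ) - C.left n (j + 1) + C.left n j ∈ C.level n j := by
    simp only [level, Set.mem_Ico] at h ⊢
    constructor <;> linarith [h.1, h.2]
  obtain ⟨i₂, hi₂, hx₂, hsub, -, ht₂⟩ := C.exists_copy (le_max_right m n) (by omega) hy
  obtain ⟨hi₂', he⟩ := ht₂ 1 hj
  have hT₂ : (C.transformation x : ℝ) ∈ C.level (max m n) (i₂ + 1) := by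
    simp only [level, Set.mem_Ico] at hx₂ ⊢
    constructor <;> linarith [hx₂.1, hx₂.2]
  have := C.eq_of_mem_level hi₁' hi₂' hT hT₂
  obtain rfl : i₁ = i₂ := by omega
  exact hsub hx₁

theorem transformation_ne_zero (x : C.space) : (C.transformation x : ℝ) ≠ 0 := by
  intro h
  obtain ⟨n, j, hj, hx⟩ := C.exists_mem_not_top x
  have h1 := C.transformation_mem_level hj hx
  have h2 : (C.transformation x : ℝ) ∈ C.level n 0 := by
    simp [h, level, left_bottom, C.width_pos n]
  exact absurd (C.eq_of_mem_level hj (by omega) h1 h2) (by omega)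

theorem measurableSet_level (n j : ℕ) : MeasurableSet (C.level n j) := measurableSet_Ico

theorem space_eq_iUnion :
    C.space = ⋃ (n : ℕ) (j : ℕ) (_ : j < C.height n), C.level n j := by
  ext x; simp [space]

theorem measurableSet_space : MeasurableSet C.space := by
  rw [space_eq_iUnion]
  exact .iUnion fun n => .iUnion fun j => .iUnion fun _ => C.measurableSet_level n j

theorem measure_apply (E : Set C.space) : C.measure E = volume (Subtype.val '' E) :=
  (MeasurableEmbedding.subtype_coe C.measurableSet_space).comap_apply _ _

/-- A level, as a subset of the space. -/
def levelSet (n j : ℕ) : Set C.space := {x | (x : ℝ) ∈ C.level n j}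

theorem measurableSet_levelSet (n j : ℕ) : MeasurableSet (C.levelSet n j) :=
  measurable_subtype_coe (C.measurableSet_level n j)

theorem measure_levelSet {n j : ℕ} (hj : j < C.height n) :
    C.measure (C.levelSet n j) = ENNReal.ofReal (C.width n) := by
  have : (Subtype.val '' C.levelSet n j : Set ℝ) = C.level n j := by
    ext x
    simp only [levelSet, Set.mem_image, Set.mem_ofPred_eq, Subtype.exists, exists_and_left,
      exists_prop, exists_eq_right_right, and_iff_left_iff_imp]
    exact fun h => ⟨n, j, hj, h⟩
  rw [measure_apply, this, level, Real.volume_Ico]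
  congr 1; ring

theorem measurable_transformation : Measurable C.transformation := by
  suffices h : Measurable fun x => (C.transformation x : ℝ) from h.subtype_mk
  intro B hB
  have : (fun x => (C.transformation x : ℝ)) ⁻¹' B =
      ⋃ (n : ℕ) (j : ℕ) (_ : j + 1 < C.height n), C.levelSet n j ∩
        (fun x : C.space => (x : ℝ) - C.left n j + C.left n (j + 1)) ⁻¹' B := by
    ext x
    simp only [Set.mem_preimage, Set.mem_iUnion, Set.mem_inter_iff, exists_prop]
    constructor
    · intro hx
      obtain ⟨n, j, hj, hxj⟩ := C.exists_mem_not_top x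
      exact ⟨n, j, hj, hxj, by rwa [← C.transformation_apply hj hxj]⟩
    · rintro ⟨n, j, hj, hxj, hx⟩
      rwa [C.transformation_apply hj hxj]
  rw [this]
  exact .iUnion fun n => .iUnion fun j => .iUnion fun _ =>
    (C.measurableSet_levelSet n j).inter
      ((by fun_prop : Measurable fun x : C.space =>
        (x : ℝ) - C.left n j + C.left n (j + 1)) hB)

theorem measure_preimage_inter_levelSet {n j : ℕ} (hj : j + 1 < C.height n) (E : Set C.space) :
    C.measure (C.transformation ⁻¹' (E ∩ C.levelSet n (j + 1))) =
      C.measure (E ∩ C.levelSet n (j + 1)) := by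
  rw [measure_apply, measure_apply,
    ← measure_preimage_add_right volume (C.left n (j + 1) - C.left n j)
      (Subtype.val '' (E ∩ C.levelSet n (j + 1)))]
  congr 1
  ext x
  simp only [Set.mem_image, Set.mem_preimage, Set.mem_inter_iff]
  constructor
  · rintro ⟨y, ⟨hE, hy⟩, rfl⟩
    have hy' := (C.transformation_mem_level_iff hj).1 hy
    exact ⟨_, ⟨hE, hy⟩, by rw [C.transformation_apply hj hy']; ring⟩
  · rintro ⟨y, ⟨hE, hy⟩, hxy⟩
    have hx : x ∈ C.level n j := by
      simp only [levelSet, level, Set.mem_ofPred_eq, Set.mem_Ico] at hy ⊢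
      constructor <;> linarith [hy.1, hy.2]
    have hT : C.transformation ⟨x, n, j, by omega, hx⟩ = y :=
      Subtype.ext (by rw [C.transformation_apply hj hx]; linarith)
    exact ⟨⟨x, n, j, by omega, hx⟩, by rw [hT]; exact ⟨hE, hy⟩, rfl⟩

theorem measurePreserving_transformation :
    MeasurePreserving C.transformation C.measure C.measure := by
  refine ⟨C.measurable_transformation, ?_⟩
  -- A countable cover on whose pieces the measures are compared: non-bottom levels, where the map
  -- is a translation, and the point `0`, which is null and has no preimage. Invalid indices give
  -- the empty set.
  let s : Option (ℕ × ℕ) → Set C.space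
    | none => {x | (x : ℝ) = 0}
    | some p => {x | p.2 + 1 < C.height p.1 ∧ x ∈ C.levelSet p.1 (p.2 + 1)}
  have hs : ⋃ i, s i = Set.univ := by
    refine Set.eq_univ_of_forall fun x => Set.mem_iUnion.2 ?_
    by_cases hx : (x : ℝ) = 0
    · exact ⟨none, hx⟩
    · obtain ⟨n, j, hj, hxj⟩ := C.exists_mem_not_bottom x hx
      exact ⟨some (n, j), hj, hxj⟩
  refine Measure.ext_of_iUnion_eq_univ hs fun i => Measure.ext fun E hE => ?_
  have hsi : MeasurableSet (s i) := by
    rcases i with _ | p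
    · exact measurable_subtype_coe (measurableSet_singleton (0 : ℝ))
    · exact (MeasurableSet.const _).inter (C.measurableSet_levelSet _ _)
  rw [Measure.restrict_apply hE, Measure.restrict_apply hE,
    Measure.map_apply C.measurable_transformation (hE.inter hsi)]
  rcases i with _ | p
  · have h1 : C.transformation ⁻¹' (E ∩ s none) = ∅ :=
      Set.eq_empty_of_forall_notMem fun x hx => C.transformation_ne_zero x hx.2
    have h2 : C.measure (E ∩ s none) = 0 := by
      rw [measure_apply]
      refine measure_mono_null (t := {0}) ?_ (by simp)
      rintro _ ⟨x, ⟨-, hx⟩, rfl⟩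
      exact hx
    rw [h1, h2, measure_empty]
  · by_cases hp : p.2 + 1 < C.height p.1
    · have : s (some p) = C.levelSet p.1 (p.2 + 1) := by
        ext x; exact and_iff_right hp
      rw [this, C.measure_preimage_inter_levelSet hp]
    · have : s (some p) = ∅ := Set.eq_empty_of_forall_notMem fun x hx => hp hx.1
      simp [this]

end RankOneConstruction

/-! ### The energy argument and the matching of pairs. -/

/-- The combinatorial core of the argument: an array `F n i j` of densities which is consistent
under refinement along `H n × H n` and invariant under diagonal shifts does not depend on `j`,
provided a fixed proportion of pairs in `H n × H n` can be matched so that a diagonal shift moves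
the second coordinate by one more than expected. -/
theorem density_eq_succ (h : ℕ → ℕ) (H : ℕ → Finset ℕ) (F : ℕ → ℕ → ℕ → ℝ)
    (hH : ∀ n, (H n).Nonempty)
    (hlt : ∀ n, ∀ p ∈ H n, ∀ i < h n, i + p < h (n + 1))
    (hF0 : ∀ n i j, 0 ≤ F n i j) (hF1 : ∀ n i j, i < h n → j < h n → F n i j ≤ 1)
    (havg : ∀ n i j, i < h n → j < h n → ((H n ×ˢ H n).card : ℝ) * F n i j =
      ∑ z ∈ H n ×ˢ H n, F (n + 1) (i + z.1) (j + z.2))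
    (hmatch : ∀ n, ∃ Q R : Finset (ℕ × ℕ), Q ⊆ H n ×ˢ H n ∧ R ⊆ H n ×ˢ H n ∧
      4 * Q.card = (H n ×ˢ H n).card ∧ 4 * R.card = (H n ×ˢ H n).card ∧
      ∀ i j, i < h n → j + 1 < h n → ∑ z ∈ Q, F (n + 1) (i + z.1) (j + z.2) =
        ∑ z ∈ R, F (n + 1) (i + z.1) (j + 1 + z.2))
    {n i j : ℕ} (hi : i < h n) (hj : j + 1 < h n) : F n i (j + 1) = F n i j := by
  have hN : ∀ n, (0 : ℝ) < (H n ×ˢ H n).card := fun n => by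
    exact_mod_cast Finset.card_pos.2 ((hH n).product (hH n))
  -- deviation of a partial average from the full average
  have dev : ∀ n i j, i < h n → j < h n → ∀ Q ⊆ H n ×ˢ H n, 4 * Q.card = (H n ×ˢ H n).card →
      ((H n ×ˢ H n).card : ℝ) *
          (F n i j - (∑ z ∈ Q, F (n + 1) (i + z.1) (j + z.2)) / Q.card) ^ 2 ≤
        4 * ((∑ z ∈ H n ×ˢ H n, F (n + 1) (i + z.1) (j + z.2) ^ 2) -
          (H n ×ˢ H n).card * F n i j ^ 2) := by
    intro n i j hi hj Q hQ hc
    have hc' : (4 : ℝ) * Q.card = (H n ×ˢ H n).card := by exact_mod_cast hc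
    have hQ0 : (0 : ℝ) < Q.card := by have := hN n; linarith
    have h1 : F n i j - (∑ z ∈ Q, F (n + 1) (i + z.1) (j + z.2)) / Q.card =
        (∑ z ∈ Q, (F n i j - F (n + 1) (i + z.1) (j + z.2))) / Q.card := by
      rw [Finset.sum_sub_distrib, Finset.sum_const, nsmul_eq_mul]; field_simp
    have h2 := sq_sum_le_card_mul_sum_sq (s := Q)
      (f := fun z => F n i j - F (n + 1) (i + z.1) (j + z.2))
    have h3 : ∑ z ∈ Q, (F n i j - F (n + 1) (i + z.1) (j + z.2)) ^ 2 ≤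
        ∑ z ∈ H n ×ˢ H n, (F n i j - F (n + 1) (i + z.1) (j + z.2)) ^ 2 :=
      Finset.sum_le_sum_of_subset_of_nonneg hQ fun _ _ _ => sq_nonneg _
    -- Variance identity: `F n i j` is the mean of its refinements.
    have h4 : ∑ z ∈ H n ×ˢ H n, (F n i j - F (n + 1) (i + z.1) (j + z.2)) ^ 2 =
        (∑ z ∈ H n ×ˢ H n, F (n + 1) (i + z.1) (j + z.2) ^ 2) -
          (H n ×ˢ H n).card * F n i j ^ 2 := by
      have := havg n i j hi hj
      simp only [sub_sq, Finset.sum_add_distrib, Finset.sum_sub_distrib, ← Finset.mul_sum,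
        Finset.sum_const, nsmul_eq_mul]
      rw [← this]; ring
    rw [← h4, h1, div_pow, ← hc']
    refine le_trans ?_ (mul_le_mul_of_nonneg_left h3 (by norm_num : (0 : ℝ) ≤ 4))
    rw [mul_assoc, mul_div_assoc', sq (Q.card : ℝ)]
    refine mul_le_mul_of_nonneg_left ?_ (by norm_num)
    rw [div_le_iff₀ (by positivity)]
    calc _ ≤ (Q.card : ℝ) * _ := mul_le_mul_of_nonneg_left h2 hQ0.le
      _ = _ := by ring
  -- The right side bounds the energy still to be gained. The inductive bounds at stage `n + 1`,
  -- summed over all pairs, add up with the energy gained in passing from `n` to `n + 1`, and the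
  -- sums of squares at stage `n + 1` cancel. The constant is `8 = 4 * 2`: `4` for the quarter of
  -- the pairs, `2` for `(a - b) ^ 2 ≤ 2 * a ^ 2 + 2 * b ^ 2`.
  have key : ∀ (K : ℕ) n i j, i < h n → j + 1 < h n →
      K * (F n i (j + 1) - F n i j) ^ 2 ≤
        8 * ((1 - F n i j ^ 2) + (1 - F n i (j + 1) ^ 2)) := by
    intro K
    induction K with
    | zero =>
      intro n i j hi hj
      have := hF1 n i j hi (by omega)
      have := hF1 n i (j + 1) hi hj
      have := hF0 n i j
      have := hF0 n i (j + 1)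
      push_cast
      nlinarith
    | succ K ih =>
      intro n i j hi hj
      obtain ⟨Q, R, hQ, hR, hcQ, hcR, hQR⟩ := hmatch n
      have dQ := dev n i j hi (by omega) Q hQ hcQ
      have dR := dev n i (j + 1) hi hj R hR hcR
      rw [← hQR i j hi hj, show R.card = Q.card by omega] at dR
      have a0 := havg n i j hi (by omega)
      have a1 := havg n i (j + 1) hi hj
      -- Cauchy–Schwarz: the squared difference at stage `n` is at most the mean of those at stage
      -- `n + 1`.
      have h1 := sq_sum_le_card_mul_sum_sq (s := H n ×ˢ H n)
        (f := fun z => F (n + 1) (i + z.1) (j + 1 + z.2) - F (n + 1) (i + z.1) (j + z.2))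
      rw [Finset.sum_sub_distrib, ← a0, ← a1, ← mul_sub, mul_pow, sq, mul_assoc] at h1
      have h2 := le_of_mul_le_mul_left h1 (hN n)
      have h3 := Finset.sum_le_sum fun z (hz : z ∈ H n ×ˢ H n) =>
        ih (n + 1) (i + z.1) (j + z.2)
          (hlt n z.1 (Finset.mem_product.1 hz).1 i hi) (by
            have := hlt n z.2 (Finset.mem_product.1 hz).2 (j + 1) hj
            omega)
      simp only [← Finset.mul_sum, Finset.sum_add_distrib, Finset.sum_sub_distrib,
        Finset.sum_const, nsmul_eq_mul, mul_one, add_right_comm j _ 1] at h3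
      have h4 := mul_le_mul_of_nonneg_left h2 (K.cast_nonneg : (0 : ℝ) ≤ K)
      set N : ℝ := ((H n ×ˢ H n).card : ℝ) with hNdef
      set S := (∑ z ∈ Q, F (n + 1) (i + z.1) (j + z.2)) / (Q.card : ℝ)
      have h5 : N * (F n i (j + 1) - F n i j) ^ 2 ≤
          2 * (N * (F n i j - S) ^ 2) + 2 * (N * (F n i (j + 1) - S) ^ 2) := by
        have : (F n i (j + 1) - F n i j) ^ 2 ≤
            2 * (F n i j - S) ^ 2 + 2 * (F n i (j + 1) - S) ^ 2 := by
          nlinarith [sq_nonneg ((F n i j - S) + (F n i (j + 1) - S))]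
        nlinarith [hN n]
      refine le_of_mul_le_mul_left ?_ (hN n)
      push_cast
      rw [← hNdef]
      linarith
  by_contra hne
  have hpos : 0 < (F n i (j + 1) - F n i j) ^ 2 := by
    have := sub_ne_zero.2 hne
    positivity
  obtain ⟨K, hK⟩ := exists_nat_gt (16 / (F n i (j + 1) - F n i j) ^ 2)
  rw [div_lt_iff₀ hpos] at hK
  have := key K n i j hi hj
  nlinarith [sq_nonneg (F n i j), sq_nonneg (F n i (j + 1))]

/-- Under diagonal shift invariance, the matching required by `density_eq_succ` is provided by the
pairs of a paired height set: `(V, w)` is matched with `(v, W)`. -/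
theorem IsPairedHeightSet.exists_match {M Γ : ℕ} {H : Finset ℕ}
    (hH : IsPairedHeightSet M Γ Γ H) (h : ℕ) {h' : ℕ} (G : ℕ → ℕ → ℝ)
    (hlt : ∀ p ∈ H, ∀ i < h, i + p < h')
    (hG : ∀ i j m, i + m < h' → j + m < h' → G (i + m) (j + m) = G i j) :
    ∃ Q R : Finset (ℕ × ℕ), Q ⊆ H ×ˢ H ∧ R ⊆ H ×ˢ H ∧
      4 * Q.card = (H ×ˢ H).card ∧ 4 * R.card = (H ×ˢ H).card ∧
      ∀ i j, i < h → j + 1 < h → ∑ z ∈ Q, G (i + z.1) (j + z.2) =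
        ∑ z ∈ R, G (i + z.1) (j + 1 + z.2) := by
  obtain ⟨V, W, v, w, hinj, hset, hsum, -⟩ := hH
  set u : Fin Γ ⊕ Fin Γ → ℕ := Sum.elim V W with hu
  set l : Fin Γ ⊕ Fin Γ → ℕ := Sum.elim v w with hl
  have hui : Function.Injective u := hinj.comp Sum.inl_injective
  have hli : Function.Injective l := hinj.comp Sum.inr_injective
  have hrange : (H : Set ℕ) = Set.range (Sum.elim u l) := by
    rw [hset, Set.Sum.elim_range, hu, hl, Set.Sum.elim_range, Set.Sum.elim_range,
      Set.union_assoc (Set.range V ∪ Set.range W)]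
  have hcard : H.card = 4 * Γ := by
    have : H = Finset.univ.image (Sum.elim u l) := by
      apply Finset.coe_injective; simp [hrange]
    rw [this, Finset.card_image_of_injective _ hinj]
    simp; ring
  have hmu : ∀ a, u a ∈ H := fun a => by
    rw [← Finset.mem_coe, hrange]; exact ⟨Sum.inl a, rfl⟩
  have hml : ∀ a, l a ∈ H := fun a => by
    rw [← Finset.mem_coe, hrange]; exact ⟨Sum.inr a, rfl⟩
  -- `swap` exchanges the two members of a pair.
  have hbar : ∀ a b, u a + u a.swap + 1 = l b + l b.swap := by
    rintro (a | a) (b | b) <;> simp only [hu, hl, Sum.swap, Sum.elim_inl, Sum.elim_inr] <;>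
      have := hsum a b <;> omega
  have huli : Function.Injective (Prod.map u l) := hui.prodMap hli
  have hlui : Function.Injective (Prod.map l u) := hli.prodMap hui
  refine ⟨Finset.univ.image (Prod.map u l), Finset.univ.image (Prod.map l u), ?_, ?_, ?_, ?_, ?_⟩
  · intro z hz
    obtain ⟨⟨a, b⟩, -, rfl⟩ := Finset.mem_image.1 hz
    exact Finset.mk_mem_product (hmu a) (hml b)
  · intro z hz
    obtain ⟨⟨a, b⟩, -, rfl⟩ := Finset.mem_image.1 hz
    exact Finset.mk_mem_product (hml a) (hmu b)
  · rw [Finset.card_image_of_injective _ huli, Finset.card_product, hcard]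
    simp; ring
  · rw [Finset.card_image_of_injective _ hlui, Finset.card_product, hcard]
    simp; ring
  · intro i j hi hj
    rw [Finset.sum_image huli.injOn, Finset.sum_image hlui.injOn]
    refine Fintype.sum_equiv
      ((Equiv.prodComm _ _).trans ((Equiv.sumComm _ _).prodCongr (Equiv.sumComm _ _))) _ _ ?_
    rintro ⟨a, b⟩
    change G (i + u a) (j + l b) = G (i + l b.swap) (j + 1 + u a.swap)
    have hab := hbar a b
    have h1 := hlt _ (hmu a) i hi
    have h2 := hlt _ (hml b) j (by omega)
    have h3 := hlt _ (hml b.swap) i hi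
    have h4 := hlt _ (hmu a.swap) (j + 1) hj
    -- The shift length `l b.swap - u a` may have either sign, whereas `hG` only shifts upwards.
    rcases le_total (u a) (l b.swap) with hle | hle
    · obtain ⟨m, hm⟩ := Nat.exists_eq_add_of_le hle
      have e1 : i + l b.swap = i + u a + m := by omega
      have e2 : j + 1 + u a.swap = j + l b + m := by omega
      rw [e1, e2, hG _ _ _ (by omega) (by omega)]
    · obtain ⟨m, hm⟩ := Nat.exists_eq_add_of_le hle
      have e1 : i + u a = i + l b.swap + m := by omega
      have e2 : j + l b = j + 1 + u a.swap + m := by omega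
      rw [e1, e2, hG _ _ _ (by omega) (by omega)]

namespace RankOneConstruction

/-! ### Products of levels as a countable generating π-system. -/

variable (C : RankOneConstruction)

instance sigmaFinite_measure : SigmaFinite C.measure := by
  refine SigmaFinite.of_map _ measurable_subtype_coe.aemeasurable ?_
  rw [measure, (MeasurableEmbedding.subtype_coe C.measurableSet_space).map_comap]
  infer_instance

/-- The product of two levels of the `n`-th column. -/
def rect (n i j : ℕ) : Set (C.space × C.space) := C.levelSet n i ×ˢ C.levelSet n j

theorem measurableSet_rect (n i j : ℕ) : MeasurableSet (C.rect n i j) :=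
  (C.measurableSet_levelSet n i).prod (C.measurableSet_levelSet n j)

theorem measure_rect {n i j : ℕ} (hi : i < C.height n) (hj : j < C.height n) :
    (C.measure.prod C.measure) (C.rect n i j) = ENNReal.ofReal (C.width n ^ 2) := by
  rw [rect, Measure.prod_prod, C.measure_levelSet hi, C.measure_levelSet hj,
    ← ENNReal.ofReal_mul (C.width_pos n).le, sq]

theorem rect_disjoint {n i j i' j' : ℕ} (hi : i < C.height n) (hj : j < C.height n)
    (hi' : i' < C.height n) (hj' : j' < C.height n) (hne : (i, j) ≠ (i', j')) :
    Disjoint (C.rect n i j) (C.rect n i' j') := by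
  refine Set.disjoint_left.2 fun z hz hz' => hne ?_
  rw [C.eq_of_mem_level hi hi' hz.1 hz'.1, C.eq_of_mem_level hj hj' hz.2 hz'.2]

theorem exists_rect_mem_open {U : Set (C.space × C.space)} (hU : IsOpen U)
    {z : C.space × C.space} (hz : z ∈ U) :
    ∃ n i j, i < C.height n ∧ j < C.height n ∧ z ∈ C.rect n i j ∧ C.rect n i j ⊆ U := by
  obtain ⟨ε, hε, hball⟩ := Metric.isOpen_iff.1 hU z hz
  obtain ⟨n₁, i₁, hi₁, hx₁⟩ := z.1.2
  obtain ⟨n₂, j₂, hj₂, hx₂⟩ := z.2.2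
  obtain ⟨n, hn, hw⟩ := C.exists_width_lt hε (max n₁ n₂)
  obtain ⟨i, hi, hxi⟩ := C.exists_mem_level_of_le ((le_max_left _ _).trans hn) hi₁ hx₁
  obtain ⟨j, hj, hxj⟩ := C.exists_mem_level_of_le ((le_max_right _ _).trans hn) hj₂ hx₂
  refine ⟨n, i, j, hi, hj, ⟨hxi, hxj⟩, fun y hy => hball ?_⟩
  have hd : ∀ (k : ℕ) (a b : C.space), (a : ℝ) ∈ C.level n k → (b : ℝ) ∈ C.level n k →
      dist a b < ε := by
    intro k a b ha hb
    rw [Subtype.dist_eq, Real.dist_eq, abs_lt]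
    simp only [level, Set.mem_Ico] at ha hb
    constructor <;> linarith [ha.1, ha.2, hb.1, hb.2]
  exact max_lt (hd i _ _ hy.1 hxi) (hd j _ _ hy.2 hxj)

/-- The products of two levels of the same column. -/
def rects : Set (Set (C.space × C.space)) :=
  {s | ∃ n i j, i < C.height n ∧ j < C.height n ∧ s = C.rect n i j}

theorem countable_rects : C.rects.Countable := by
  refine (Set.countable_range fun p : ℕ × ℕ × ℕ => C.rect p.1 p.2.1 p.2.2).mono ?_
  rintro s ⟨n, i, j, -, -, rfl⟩
  exact ⟨(n, i, j), rfl⟩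

theorem generateFrom_rects :
    (inferInstance : MeasurableSpace (C.space × C.space)) =
      MeasurableSpace.generateFrom C.rects := by
  refine le_antisymm ?_ (MeasurableSpace.generateFrom_le ?_)
  · rw [BorelSpace.measurable_eq (α := C.space × C.space)]
    refine MeasurableSpace.generateFrom_le fun U hU => ?_
    have : U = ⋃₀ {s ∈ C.rects | s ⊆ U} := by
      refine Set.Subset.antisymm (fun z hz => ?_) (Set.sUnion_subset fun s hs => hs.2)
      obtain ⟨n, i, j, hi, hj, hzr, hsub⟩ := C.exists_rect_mem_open hU hz
      exact ⟨_, ⟨⟨n, i, j, hi, hj, rfl⟩, hsub⟩, hzr⟩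
    rw [this]
    exact .sUnion (C.countable_rects.mono fun s hs => hs.1)
      fun s hs => MeasurableSpace.measurableSet_generateFrom hs.1
  · rintro s ⟨n, i, j, -, -, rfl⟩
    exact C.measurableSet_rect n i j

theorem sUnion_rects : ⋃₀ C.rects = Set.univ := by
  refine Set.eq_univ_of_forall fun z => ?_
  obtain ⟨n, i, j, hi, hj, hz, -⟩ := C.exists_rect_mem_open isOpen_univ (Set.mem_univ z)
  exact ⟨_, ⟨n, i, j, hi, hj, rfl⟩, hz⟩

theorem rect_subset_of_nonempty {n m i j i' j' : ℕ} (hnm : n ≤ m) (hi : i < C.height n)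
    (hj : j < C.height n) (hi' : i' < C.height m) (hj' : j' < C.height m)
    (hne : (C.rect n i j ∩ C.rect m i' j').Nonempty) : C.rect m i' j' ⊆ C.rect n i j := by
  obtain ⟨z, hz, hz'⟩ := hne
  have h1 := (C.level_subset_or_disjoint hnm hi hi').resolve_right
    (Set.not_disjoint_iff.2 ⟨_, hz'.1, hz.1⟩)
  have h2 := (C.level_subset_or_disjoint hnm hj hj').resolve_right
    (Set.not_disjoint_iff.2 ⟨_, hz'.2, hz.2⟩)
  exact Set.prod_mono (fun x hx => h1 hx) fun x hx => h2 hx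

/-- Levels of different columns are nested or disjoint, so two rectangles that meet are nested. -/
theorem isPiSystem_rects : IsPiSystem C.rects := by
  rintro _ ⟨n, i, j, hi, hj, rfl⟩ _ ⟨m, i', j', hi', hj', rfl⟩ hne
  rcases le_total n m with h | h
  · rw [Set.inter_eq_right.2 (C.rect_subset_of_nonempty h hi hj hi' hj' hne)]
    exact ⟨m, i', j', hi', hj', rfl⟩
  · rw [Set.inter_eq_left.2
      (C.rect_subset_of_nonempty h hi' hj' hi hj (by rwa [Set.inter_comm]))]
    exact ⟨n, i, j, hi, hj, rfl⟩

theorem add_lt_height_succ {n p i : ℕ} (hp : p ∈ C.heightSet n) (hi : i < C.height n) :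
    i + p < C.height (n + 1) := by
  obtain ⟨k, hk, rfl⟩ := Finset.mem_image.1 hp
  rw [add_comm]
  exact C.offset_add_lt (Finset.mem_range.1 hk) hi

theorem mem_levelSet_iff {n j : ℕ} (hj : j < C.height n) (x : C.space) :
    x ∈ C.levelSet n j ↔ ∃ p ∈ C.heightSet n, x ∈ C.levelSet (n + 1) (j + p) := by
  constructor
  · intro hx
    obtain ⟨k, hk, hxk⟩ := C.exists_mem_level_succ hj hx
    rw [add_comm (C.offset n k)] at hxk
    exact ⟨_, Finset.mem_image_of_mem _ (Finset.mem_range.2 hk), hxk⟩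
  · rintro ⟨p, hp, hx⟩
    obtain ⟨k, hk, rfl⟩ := Finset.mem_image.1 hp
    rw [add_comm j] at hx
    exact C.level_subset (Finset.mem_range.1 hk) hj hx

theorem rect_eq_biUnion {n i j : ℕ} (hi : i < C.height n) (hj : j < C.height n) :
    C.rect n i j =
      ⋃ z ∈ C.heightSet n ×ˢ C.heightSet n, C.rect (n + 1) (i + z.1) (j + z.2) := by
  ext z
  simp only [rect, Set.mem_prod, C.mem_levelSet_iff hi, C.mem_levelSet_iff hj, Set.mem_iUnion,
    Finset.mem_product, Prod.exists, exists_prop]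
  constructor
  · rintro ⟨⟨p, hp, hp'⟩, q, hq, hq'⟩
    exact ⟨p, q, ⟨hp, hq⟩, hp', hq'⟩
  · rintro ⟨p, q, ⟨hp, hq⟩, hp', hq'⟩
    exact ⟨⟨p, hp, hp'⟩, q, hq, hq'⟩

theorem preimage_rect {n i j : ℕ} (hi : i + 1 < C.height n) (hj : j + 1 < C.height n) :
    Prod.map C.transformation C.transformation ⁻¹' C.rect n (i + 1) (j + 1) = C.rect n i j := by
  ext z
  exact and_congr (C.transformation_mem_level_iff hi) (C.transformation_mem_level_iff hj)

theorem measurePreserving_prodMap :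
    MeasurePreserving (Prod.map C.transformation C.transformation)
      (C.measure.prod C.measure) (C.measure.prod C.measure) :=
  C.measurePreserving_transformation.prod C.measurePreserving_transformation

/-! ### Densities of an invariant set. -/

/-- The proportion of the product of the levels `i` and `j` of column `n` that lies in `A`. -/
noncomputable def density (A : Set (C.space × C.space)) (n i j : ℕ) : ℝ :=
  (C.measure.prod C.measure).real (A ∩ C.rect n i j) / C.width n ^ 2

variable {A : Set (C.space × C.space)}

theorem measure_inter_rect_ne_top {n i j : ℕ} (hi : i < C.height n) (hj : j < C.height n) :
    (C.measure.prod C.measure) (A ∩ C.rect n i j) ≠ ⊤ :=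
  measure_ne_top_of_subset Set.inter_subset_right
    (by rw [C.measure_rect hi hj]; exact ENNReal.ofReal_ne_top)

theorem density_nonneg (n i j : ℕ) : 0 ≤ C.density A n i j :=
  div_nonneg measureReal_nonneg (sq_nonneg _)

theorem density_le_one {n i j : ℕ} (hi : i < C.height n) (hj : j < C.height n) :
    C.density A n i j ≤ 1 := by
  have hr := C.measure_rect hi hj
  refine div_le_one_of_le₀ ?_ (sq_nonneg _)
  refine (measureReal_mono Set.inter_subset_right (by rw [hr]; exact ENNReal.ofReal_ne_top)).trans
    (le_of_eq ?_)
  rw [measureReal_def, hr, ENNReal.toReal_ofReal (sq_nonneg _)]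

/-- A rectangle splits into `r n ^ 2` disjoint rectangles of equal measure, one for each pair of
heights. -/
theorem card_mul_density (hA : MeasurableSet A) {n i j : ℕ} (hi : i < C.height n)
    (hj : j < C.height n) :
    ((C.heightSet n ×ˢ C.heightSet n).card : ℝ) * C.density A n i j =
      ∑ z ∈ C.heightSet n ×ˢ C.heightSet n, C.density A (n + 1) (i + z.1) (j + z.2) := by
  have hlt : ∀ z ∈ C.heightSet n ×ˢ C.heightSet n,
      i + z.1 < C.height (n + 1) ∧ j + z.2 < C.height (n + 1) := fun z hz =>
    ⟨C.add_lt_height_succ (Finset.mem_product.1 hz).1 hi,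
      C.add_lt_height_succ (Finset.mem_product.1 hz).2 hj⟩
  have hsum : (C.measure.prod C.measure).real (A ∩ C.rect n i j) =
      ∑ z ∈ C.heightSet n ×ˢ C.heightSet n,
        (C.measure.prod C.measure).real (A ∩ C.rect (n + 1) (i + z.1) (j + z.2)) := by
    rw [C.rect_eq_biUnion hi hj, Set.inter_iUnion₂]
    refine measureReal_biUnion_finset ?_ (fun z _ => hA.inter (C.measurableSet_rect _ _ _))
      fun z hz => C.measure_inter_rect_ne_top (hlt z hz).1 (hlt z hz).2
    intro z hz z' hz' hne
    refine (C.rect_disjoint (hlt z hz).1 (hlt z hz).2 (hlt z' hz').1 (hlt z' hz').2 ?_).mono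
      Set.inter_subset_right Set.inter_subset_right
    intro h
    rw [Prod.mk.injEq] at h
    exact hne (Prod.ext (by omega) (by omega))
  have hw := C.r_mul_width n
  have hp := C.width_pos (n + 1)
  have hr : (0 : ℝ) < C.r n := by exact_mod_cast C.r_pos n
  simp only [density, ← Finset.sum_div]
  rw [← hsum, Finset.card_product, C.card_heightSet, ← hw]
  push_cast
  field_simp

theorem density_succ_succ (hA : MeasurableSet A)
    (hinv : Prod.map C.transformation C.transformation ⁻¹' A = A) {n i j : ℕ}
    (hi : i + 1 < C.height n) (hj : j + 1 < C.height n) :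
    C.density A n (i + 1) (j + 1) = C.density A n i j := by
  rw [density, density, measureReal_def, measureReal_def,
    ← C.measurePreserving_prodMap.measure_preimage
      (hA.inter (C.measurableSet_rect _ _ _)).nullMeasurableSet,
    Set.preimage_inter, hinv, C.preimage_rect hi hj]

theorem density_add_add (hA : MeasurableSet A)
    (hinv : Prod.map C.transformation C.transformation ⁻¹' A = A) {n i j m : ℕ}
    (hi : i + m < C.height n) (hj : j + m < C.height n) :
    C.density A n (i + m) (j + m) = C.density A n i j := by
  induction m with
  | zero => rfl
  | succ m ih =>
    rw [← ih (by omega) (by omega)]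
    exact C.density_succ_succ hA hinv hi hj

theorem density_eq {M Γ : ℕ → ℕ} (hH : ∀ k, IsPairedHeightSet (M k) (Γ k) (Γ k) (C.heightSet k))
    (hA : MeasurableSet A) (hinv : Prod.map C.transformation C.transformation ⁻¹' A = A)
    {n i j : ℕ} (hi : i < C.height n) (hj : j < C.height n) :
    C.density A n i j = C.density A 0 0 0 := by
  have hne : ∀ n, (C.heightSet n).Nonempty := fun n => by
    rw [← Finset.card_pos, C.card_heightSet]; exact C.r_pos n
  have hstep : ∀ {n i j}, i < C.height n → j + 1 < C.height n →
      C.density A n i (j + 1) = C.density A n i j := fun {n i j} =>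
    density_eq_succ C.height C.heightSet (C.density A) hne
      (fun n p hp i hi => C.add_lt_height_succ hp hi) C.density_nonneg
      (fun n i j => C.density_le_one) (fun n i j => C.card_mul_density hA)
      (fun n => (hH n).exists_match (C.height n) (C.density A (n + 1))
        (fun p hp i hi => C.add_lt_height_succ hp hi) fun i j m => C.density_add_add hA hinv)
  have hrow : ∀ {n i} j, i < C.height n → j < C.height n →
      C.density A n i j = C.density A n i 0 := by
    intro n i j hi
    induction j with
    | zero => exact fun _ => rfl
    | succ j ih => exact fun hj => (hstep hi hj).trans (ih (by omega))
  -- Move along the row from `(i, j)` to `(i, i)`, then down the diagonal to `(0, 0)`.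
  have hbase : ∀ {n i j}, i < C.height n → j < C.height n →
      C.density A n i j = C.density A n 0 0 := by
    intro n i j hi hj
    rw [hrow j hi hj, ← hrow i hi hi]
    simpa using C.density_add_add hA hinv (i := 0) (j := 0) (m := i) (by omega) (by omega)
  rw [hbase hi hj]
  clear hi hj i j
  induction n with
  | zero => rfl
  | succ n ih =>
    rw [← ih]
    -- Successive stages agree because a mean of equal densities is their common value.
    have h := C.card_mul_density hA (C.height_pos n) (C.height_pos n)
    rw [Finset.sum_congr rfl fun z hz => hbase
      (C.add_lt_height_succ (Finset.mem_product.1 hz).1 (C.height_pos n))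
      (C.add_lt_height_succ (Finset.mem_product.1 hz).2 (C.height_pos n)),
      Finset.sum_const, nsmul_eq_mul] at h
    refine (mul_left_cancel₀ ?_ h).symm
    exact_mod_cast (Finset.card_pos.2 ((hne n).product (hne n))).ne'

theorem restrict_eq_smul {M Γ : ℕ → ℕ}
    (hH : ∀ k, IsPairedHeightSet (M k) (Γ k) (Γ k) (C.heightSet k))
    (hA : MeasurableSet A) (hinv : Prod.map C.transformation C.transformation ⁻¹' A = A) :
    (C.measure.prod C.measure).restrict A =
      ENNReal.ofReal (C.density A 0 0 0) • C.measure.prod C.measure := by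
  have hfin : ∀ s ∈ C.rects, (C.measure.prod C.measure).restrict A s ≠ ⊤ := by
    rintro _ ⟨n, i, j, hi, hj, rfl⟩
    rw [Measure.restrict_apply (C.measurableSet_rect n i j), Set.inter_comm]
    exact C.measure_inter_rect_ne_top hi hj
  refine Measure.ext_of_generateFrom_of_cover_subset C.generateFrom_rects C.isPiSystem_rects
    subset_rfl C.countable_rects C.sUnion_rects hfin ?_
  rintro _ ⟨n, i, j, hi, hj, rfl⟩
  have hw := C.width_pos n
  rw [Measure.restrict_apply (C.measurableSet_rect n i j), Set.inter_comm, Measure.smul_apply,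
    smul_eq_mul, C.measure_rect hi hj, ← ENNReal.ofReal_mul (C.density_nonneg _ _ _),
    ← C.density_eq hH hA hinv hi hj, density, div_mul_cancel₀ _ (by positivity),
    ofReal_measureReal (C.measure_inter_rect_ne_top hi hj)]

end RankOneConstruction

/-! ### Ergodicity of the product. -/

theorem theoremT (C : RankOneConstruction) (M Γ γ : ℕ → ℕ)
    (hpos : ∀ k, 0 < Γ k) (heq : ∀ k, γ k = Γ k)
    (hH : ∀ k, IsPairedHeightSet (M k) (Γ k) (γ k) (C.heightSet k)) :
    Ergodic (Prod.map C.transformation C.transformation)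
      (C.measure.prod C.measure) := by
  obtain rfl : γ = Γ := funext heq
  refine ⟨C.measurePreserving_prodMap, ⟨fun A hA hinv => ?_⟩⟩
  -- The restriction to `A` vanishes on `Aᶜ`, so the constant density or the measure of `Aᶜ` is `0`.
  have h := congrArg (fun ν => ν Aᶜ) (C.restrict_eq_smul hH hA hinv)
  simp only [Measure.restrict_apply hA.compl, Set.compl_inter_self, measure_empty,
    Measure.smul_apply, smul_eq_mul] at h
  rw [Filter.eventuallyConst_set']
  rcases mul_eq_zero.1 h.symm with h | h
  · left
    have h' := congrArg (fun ν => ν Set.univ) (C.restrict_eq_smul hH hA hinv)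
    simp only [Measure.restrict_apply MeasurableSet.univ, Set.univ_inter, h, zero_smul,
      Measure.coe_zero, Pi.zero_apply] at h'
    exact ae_eq_empty.2 h'
  · exact .inr (ae_eq_univ.2 h)
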